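/- A \emph{Diophantine equation} is an equation $D(x_1,\ldots,x_p)=0$, where $p\in\mathbb N$ and $D\in\mathbb Z[x_1,\ldots,x_p]$; the number $p$ of variables is part of the equation, and a variable may have no occurrence in $D$. Its solutions in non-negative integers are the tuples $(x_1,\ldots,x_p)\in\mathbb N^p$ with $D(x_1,\ldots,x_p)=0$. The polynomial $D$ \emph{depends on all the variables} $x_1,\ldots,x_p$ if each $x_i$ occurs in some monomial of $D$ with non-zero coefficient. A set $A$ of Diophantine equations is \emph{recursively enumerable} if there is an algorithm which, given $p$ and a finite list of integer coefficients with exponent vectors whose sum of terms is $D$, halts if and only if the equation $D(x_1,\ldots,x_p)=0$ belongs to $A$. \textbf{Corollary.} (1) The set of all Diophantine equations which have at most finitely many solutions in non-negative integers is not recursively enumerable. (2) Let $\mathcal M$ be the set of all Diophantine equations $D(x_1,\ldots,x_p)=0$ such that $p\geqslant 1$ and $D$ depends on all the variables $x_1,\ldots,x_p$. The set of all equations from $\mathcal M$ which have at most finitely many solutions in non-negative integers is not recursively enumerable. -/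

import Mathlib

/-- A Diophantine equation `D(x₁, …, x_p) = 0`: the number `p` of its variables together with a
polynomial `D` with integer coefficients in these `p` variables. Variables that do not occur in `D`
are still counted, so `D(x₁, …, x_p) = 0` and `D(x₁, …, x_p) + 0 · x_{p+1} = 0` are different
equations. -/
structure DiophantineEquation where
  numVars : ℕ
  poly : MvPolynomial (Fin numVars) ℤ

namespace DiophantineEquation

/-- The solutions of the equation in non-negative integers. -/
def natSolutions (E : DiophantineEquation) : Set (Fin E.numVars → ℕ) :=
  {x | MvPolynomial.eval (fun i => (x i : ℤ)) E.poly = 0}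

/-- The polynomial of the equation depends on all the variables `x₁, …, x_p`: each of them occurs
in a monomial with a nonzero coefficient. -/
def DependsOnAllVariables (E : DiophantineEquation) : Prop :=
  ∀ i : Fin E.numVars, i ∈ E.poly.vars

/-- A finite presentation of a Diophantine equation: the number of variables and a list of terms,
each given by its integer coefficient and the list of its exponents. -/
abbrev Code : Type := ℕ × List (ℤ × List ℕ)

/-- The term `c · x₁ ^ e₁ ⋯ x_p ^ e_p` given by `(c, [e₁, …, e_p])`; missing exponents are `0` and
superfluous ones are ignored. -/
noncomputable def termOf (p : ℕ) (t : ℤ × List ℕ) : MvPolynomial (Fin p) ℤ :=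
  MvPolynomial.C t.1 * ∏ i : Fin p, MvPolynomial.X i ^ t.2.getD i 0

/-- The equation presented by a code: the sum of the listed terms is set equal to zero. -/
noncomputable def ofCode (c : Code) : DiophantineEquation where
  numVars := c.1
  poly := (c.2.map (termOf c.1)).sum

/-- Every Diophantine equation has a code. -/
theorem ofCode_surjective : Function.Surjective ofCode := by
  rintro ⟨p, D⟩
  suffices h : ∃ l : List (ℤ × List ℕ), (l.map (termOf p)).sum = D by
    obtain ⟨l, rfl⟩ := h
    exact ⟨(p, l), rfl⟩
  induction D using MvPolynomial.induction_on' with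
  | monomial u a =>
    refine ⟨[(a, List.ofFn fun i => u i)], ?_⟩
    simp [termOf, MvPolynomial.monomial_eq, Finsupp.prod_fintype]
  | add f g hf hg =>
    obtain ⟨l, rfl⟩ := hf
    obtain ⟨m, rfl⟩ := hg
    exact ⟨l ++ m, by simp⟩

/-- A set of Diophantine equations is recursively enumerable: there is an algorithm which, given a
presentation of an equation, halts if and only if the equation belongs to the set. -/
def IsRecursivelyEnumerable (A : Set DiophantineEquation) : Prop :=
  REPred fun c : Code => ofCode c ∈ A

end DiophantineEquation

/-! The complement of an undecidable r.e. set is reduced to finiteness of the solution set. Let `p`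
be r.e. with non-r.e. complement. By MRDP, `p n` holds iff `q(n, t) = 0` for some natural `t`. The
equation `(q² + x₁ + (x₀ - n)²) · ∏ (xᵢ + 1) = 0`, with a further variable `x₂` absent from `q`, has
no natural solutions if `p n` fails and infinitely many otherwise, since `x₂` is then free. The
product never vanishes on naturals but makes every variable occur, so one reduction serves both
claims. A code of the equation is computable from `n`; an enumeration of the finite cases would
therefore enumerate the complement of `p`.

MRDP starts from the Diophantine nature of exponentiation (`Dioph.pow_dioph`). It yields binomials
and factorials, hence bounded universal quantifiers (`Dioph.forall_lt_dioph`); with Gödel's β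
function these handle primitive recursion and minimization, by induction on `Nat.Partrec`. -/

/-! ### Binomials and factorials from exponentiation -/

theorem Nat.sum_mul_pow_div_pow_mod {B : ℕ} (k : ℕ) :
    ∀ (m : ℕ) (a : ℕ → ℕ), (∀ i, a i < B) → (∀ i, m ≤ i → a i = 0) →
      (∑ i ∈ Finset.range m, a i * B ^ i) / B ^ k % B = a k := by
  induction k with
  | zero =>
    intro m a ha hm
    cases m with
    | zero => simp [hm 0 le_rfl]
    | succ m =>
      rw [Finset.sum_range_succ']
      have : ∑ i ∈ Finset.range m, a (i + 1) * B ^ (i + 1) =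
          B * ∑ i ∈ Finset.range m, a (i + 1) * B ^ i := by
        rw [Finset.mul_sum]
        exact Finset.sum_congr rfl fun i _ => by ring
      simp [this, Nat.mod_eq_of_lt (ha 0)]
  | succ k ih =>
    intro m a ha hm
    cases m with
    | zero => simp [hm (k + 1) (Nat.zero_le _)]
    | succ m =>
      have hB : 0 < B := (Nat.zero_le _).trans_lt (ha 0)
      rw [Finset.sum_range_succ']
      have : ∑ i ∈ Finset.range m, a (i + 1) * B ^ (i + 1) =
          B * ∑ i ∈ Finset.range m, a (i + 1) * B ^ i := by
        rw [Finset.mul_sum]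
        exact Finset.sum_congr rfl fun i _ => by ring
      rw [this, pow_succ', ← Nat.div_div_eq_div_mul, pow_zero, mul_one,
        Nat.mul_add_div hB, Nat.div_eq_of_lt (ha 0), add_zero]
      exact ih m (fun i => a (i + 1)) (fun i => ha _) fun i hi => hm _ (by omega)

/-- In base `B = 2 ^ (n + 1)` the digits of `(B + 1) ^ n` are the binomial coefficients, all at most
`2 ^ n < B`. -/
theorem Nat.choose_eq_pow_div_pow_mod (n k : ℕ) :
    n.choose k = (2 ^ (n + 1) + 1) ^ n / (2 ^ (n + 1)) ^ k % 2 ^ (n + 1) := by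
  have h := Nat.sum_mul_pow_div_pow_mod (B := 2 ^ (n + 1)) k (n + 1) (fun i => n.choose i)
    (fun i => (Nat.choose_le_two_pow n i).trans_lt (Nat.pow_lt_pow_right one_lt_two n.lt_succ_self))
    (fun i hi => Nat.choose_eq_zero_of_lt hi)
  rw [add_pow, ← h]
  simp [mul_comm]

/-- The quotient `r ^ n / C(r, n)` is `n!` times `r ^ n / (r (r - 1) ⋯ (r - n + 1))`, which tends to
1 from above. Since `n! ≤ n ^ n`, this `r` exceeds `(n! + 1) n²`, enough to keep the error below 1.
-/
theorem Nat.factorial_eq_pow_div_choose (n : ℕ) :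
    n.factorial = ((n ^ n + 1) * n ^ 2 + n + 1) ^ n / ((n ^ n + 1) * n ^ 2 + n + 1).choose n := by
  set r := (n ^ n + 1) * n ^ 2 + n + 1 with hr
  have hnr : n ≤ r := by omega
  have hle := Nat.descFactorial_le_pow r n
  have hdc := Nat.descFactorial_eq_factorial_mul_choose r n
  symm
  apply Nat.div_eq_of_lt_le
  · rwa [hdc] at hle
  rcases Nat.eq_zero_or_pos n with rfl | hn
  · simp
  have h1 : (r + 1 - n) ^ n ≤ r.descFactorial n := Nat.pow_sub_le_descFactorial r n
  have hf : n.factorial ≤ n ^ n := Nat.factorial_le_pow n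
  have hfp := n.factorial_pos
  have hC := Nat.choose_pos hnr
  -- Bernoulli's inequality
  have h2 : r ^ n ≤ (r + 1 - n) ^ n + n * n * r ^ (n - 1) := by
    obtain ⟨s, hs⟩ := Nat.exists_eq_add_of_le hnr
    have h3 := one_add_mul_le_pow (a := -(n / r : ℚ)) (by
      have : (n / r : ℚ) ≤ 1 := div_le_one_of_le₀ (by exact_mod_cast hnr) (by positivity)
      linarith) n
    have hr0 : (0 : ℚ) < r := by exact_mod_cast (by omega : 0 < r)
    have h4 : (r : ℚ) ^ n * (1 + n * -(n / r : ℚ)) ≤ (r - n : ℚ) ^ n := by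
      calc _ ≤ (r : ℚ) ^ n * (1 + -(n / r : ℚ)) ^ n := by gcongr
        _ = _ := by rw [← mul_pow]; congr 1; field_simp; ring
    have h5 : (r : ℚ) ^ n = r ^ (n - 1) * r := by
      rw [← pow_succ, Nat.sub_add_cancel hn]
    have h6 : (r : ℚ) ^ n * (1 + n * -(n / r : ℚ)) = r ^ n - n * n * r ^ (n - 1) := by
      rw [mul_add, h5]; field_simp; ring
    have h7 : (r - n : ℚ) ^ n ≤ ((r + 1 - n : ℕ) : ℚ) ^ n := by
      have : ((r + 1 - n : ℕ) : ℚ) = r + 1 - n := by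
        rw [Nat.cast_sub (by omega)]; push_cast; ring
      rw [this]
      have : (n : ℚ) ≤ r := by exact_mod_cast hnr
      gcongr; linarith
    have : (r : ℚ) ^ n ≤ ((r + 1 - n : ℕ) : ℚ) ^ n + n * n * r ^ (n - 1) := by linarith
    exact_mod_cast this
  have h8 : (n.factorial + 1) * (n * n * r ^ (n - 1)) < r ^ n := by
    have : r ^ n = r ^ (n - 1) * r := by rw [← pow_succ, Nat.sub_add_cancel hn]
    rw [this]
    have : (n.factorial + 1) * (n * n) < r := by nlinarith
    have hp : 0 < r ^ (n - 1) := by positivity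
    calc _ = r ^ (n - 1) * ((n.factorial + 1) * (n * n)) := by ring
      _ < _ := by gcongr
  have h9 : (n.factorial + 1) * r ^ n < (n.factorial + 1) * r.descFactorial n + r ^ n := by
    calc _ ≤ (n.factorial + 1) * ((r + 1 - n) ^ n + n * n * r ^ (n - 1)) := by gcongr
      _ < _ := by nlinarith
  have h10 : n.factorial * r ^ n < n.factorial * ((n.factorial + 1) * r.choose n) := by
    rw [hdc] at h9; nlinarith
  exact Nat.lt_of_mul_lt_mul_left h10

namespace Dioph

open Sum

section

variable {α : Type} {f g : (α → ℕ) → ℕ}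

theorem choose_dioph (df : DiophFn f) (dg : DiophFn g) :
    DiophFn fun v => (f v).choose (g v) := by
  simp only [Nat.choose_eq_pow_div_pow_mod]
  have h2 := pow_dioph (const_dioph 2) (add_dioph df (const_dioph 1))
  exact mod_dioph (div_dioph (pow_dioph (add_dioph h2 (const_dioph 1)) df) (pow_dioph h2 dg)) h2

theorem factorial_dioph (df : DiophFn f) : DiophFn fun v => (f v).factorial := by
  simp only [Nat.factorial_eq_pow_div_choose]
  have hr := add_dioph (add_dioph (mul_dioph (add_dioph (pow_dioph df df) (const_dioph 1))
    (pow_dioph df (const_dioph 2))) df) (const_dioph 1)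
  exact div_dioph (pow_dioph hr df) (choose_dioph hr df)

theorem exists_dioph {P : (α → ℕ) → ℕ → Prop}
    (h : Dioph {w : Option α → ℕ | P (w ∘ some) (w none)}) : Dioph {v | ∃ x, P v x} :=
  ex1_dioph h

theorem exists_pi_dioph {β : Type} {P : (α → ℕ) → (β → ℕ) → Prop}
    (h : Dioph {w : α ⊕ β → ℕ | P (w ∘ inl) (w ∘ inr)}) : Dioph {v | ∃ x, P v x} :=
  ex_dioph h

theorem forall_finite_dioph {ι : Type} [Finite ι] {P : (α → ℕ) → ι → Prop}
    (h : ∀ i, Dioph {v | P v i}) : Dioph {v | ∀ i, P v i} := by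
  have := Fintype.ofFinite ι
  refine (DiophList.forall (Finset.univ.toList.map fun i : ι => {v | P v i}) ?_).ext fun v => ?_
  · simpa [List.forall_iff_forall_mem] using h
  · simp [List.forall_iff_forall_mem]

end

end Dioph

/-! ### Finite support, majorants and congruences for polynomials -/

namespace Poly

variable {α β : Type*}

theorem exists_finset_dependence (p : Poly α) :
    ∃ s : Finset α, ∀ v w : α → ℕ, (∀ i ∈ s, v i = w i) → p v = p w := by
  classical
  induction p using Poly.induction with
  | H1 i => exact ⟨{i}, fun v w h => by simp [h i (Finset.mem_singleton_self i)]⟩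
  | H2 n => exact ⟨∅, fun v w _ => by simp⟩
  | H3 f g hf hg =>
    obtain ⟨s, hs⟩ := hf
    obtain ⟨t, ht⟩ := hg
    refine ⟨s ∪ t, fun v w h => ?_⟩
    simp [hs v w fun i hi => h i (Finset.mem_union_left _ hi),
      ht v w fun i hi => h i (Finset.mem_union_right _ hi)]
  | H4 f g hf hg =>
    obtain ⟨s, hs⟩ := hf
    obtain ⟨t, ht⟩ := hg
    refine ⟨s ∪ t, fun v w h => ?_⟩
    simp [hs v w fun i hi => h i (Finset.mem_union_left _ hi),
      ht v w fun i hi => h i (Finset.mem_union_right _ hi)]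

/-- Replacing constants by their absolute values and differences by sums gives a majorant. -/
theorem exists_monotone_bound (p : Poly α) :
    ∃ q : Poly α, ∀ v w : α → ℕ, v ≤ w → |p v| ≤ q w := by
  induction p using Poly.induction with
  | H1 i => exact ⟨Poly.proj i, fun v w h => by simpa using h i⟩
  | H2 n => exact ⟨Poly.const |n|, fun v w _ => by simp⟩
  | H3 f g hf hg =>
    obtain ⟨s, hs⟩ := hf
    obtain ⟨t, ht⟩ := hg
    exact ⟨s + t, fun v w h => (abs_sub _ _).trans (add_le_add (hs v w h) (ht v w h))⟩
  | H4 f g hf hg =>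
    obtain ⟨s, hs⟩ := hf
    obtain ⟨t, ht⟩ := hg
    refine ⟨s * t, fun v w h => ?_⟩
    rw [Poly.mul_apply, Poly.mul_apply, abs_mul]
    exact mul_le_mul (hs v w h) (ht v w h) (abs_nonneg _) ((abs_nonneg _).trans (hs v w h))

theorem modEq_of_forall_modEq (p : Poly α) {n : ℕ} {v w : α → ℕ} (h : ∀ i, v i ≡ w i [MOD n]) :
    p v ≡ p w [ZMOD n] := by
  induction p using Poly.induction with
  | H1 i => simpa using Int.natCast_modEq_iff.2 (h i)
  | H2 n => simp
  | H3 f g hf hg => exact hf.sub hg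
  | H4 f g hf hg => exact hf.mul hg

end Poly

theorem Dioph.exists_fin_poly {α : Type} {S : Set (α → ℕ)} (h : Dioph S) :
    ∃ (m : ℕ) (p : Poly (α ⊕ Fin m)), ∀ v, v ∈ S ↔ ∃ t, p (Sum.elim v t) = 0 := by
  classical
  obtain ⟨β, p, hp⟩ := h
  obtain ⟨s, hs⟩ := p.exists_finset_dependence
  -- The extra point `none` receives all the auxiliary variables on which `p` does not depend.
  obtain ⟨m, ⟨e⟩⟩ : ∃ m, Nonempty (Option s ≃ Fin m) := Finite.exists_equiv_fin _
  let c : β → Fin m := fun b =>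
    if hb : Sum.inr b ∈ s then e (some ⟨Sum.inr b, hb⟩) else e none
  have hc (v : α → ℕ) (t : Fin m → ℕ) :
      Sum.elim v t ∘ Sum.elim Sum.inl (Sum.inr ∘ c) = Sum.elim v (t ∘ c) := by
    funext i; cases i <;> rfl
  refine ⟨m, p.map (Sum.elim Sum.inl (Sum.inr ∘ c)), fun v => (hp v).trans ⟨?_, ?_⟩⟩
  · rintro ⟨t, ht⟩
    refine ⟨fun j => Option.elim (e.symm j) 0 fun i => Sum.elim v t i, ?_⟩
    rw [Poly.map_apply, hc, ← ht]
    refine hs _ _ fun i hi => ?_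
    cases i with
    | inl a => rfl
    | inr b => simp [c, hi]
  · rintro ⟨t, ht⟩
    rw [Poly.map_apply, hc] at ht
    exact ⟨_, ht⟩

/-! ### Elimination of the bounded universal quantifier -/

namespace BoundedQuantifier

open Nat

/-- The `k`-th of the pairwise coprime moduli attached to `Q`. -/
def modulus (Q k : ℕ) : ℕ := Q ! ^ 2 / (k + 1) - 1

variable {Q u k l : ℕ}

theorem mul_modulus_add_one (hk : k < Q) :
    (k + 1) * (modulus Q k + 1) = Q ! ^ 2 := by
  have hd : k + 1 ∣ Q ! ^ 2 := (Nat.dvd_factorial k.succ_pos hk).trans (dvd_pow_self _ two_ne_zero)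
  have hp : 0 < Q ! ^ 2 := by positivity
  have h1 : 0 < Q ! ^ 2 / (k + 1) := Nat.div_pos (Nat.le_of_dvd hp hd) k.succ_pos
  rw [modulus, Nat.sub_add_cancel h1, Nat.mul_div_cancel' hd]

theorem factorial_dvd_modulus_add_one (hk : k < Q) : Q ! ∣ modulus Q k + 1 := by
  obtain ⟨c, hc⟩ := Nat.dvd_factorial k.succ_pos hk
  refine ⟨c, Nat.eq_of_mul_eq_mul_left k.succ_pos ?_⟩
  have := mul_modulus_add_one hk
  simp only [Nat.succ_eq_add_one] at *
  rw [this, sq]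
  nth_rewrite 2 [hc]
  ring

theorem one_lt_modulus (hQ : 3 ≤ Q) (hk : k < Q) : 1 < modulus Q k := by
  have h1 := Nat.le_of_dvd (Nat.succ_pos _) (factorial_dvd_modulus_add_one hk)
  have h2 : 3 ! ≤ Q ! := Nat.factorial_le hQ
  have h3 : 3 ! = 6 := rfl
  omega

theorem coprime_modulus_factorial (hk : k < Q) : (modulus Q k).Coprime Q ! := by
  refine Nat.Coprime.coprime_dvd_right (factorial_dvd_modulus_add_one hk) ?_
  simp

/-- A common prime factor would divide `l - k`, hence `Q !`, to which the moduli are coprime. -/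
theorem coprime_modulus (hk : k < Q) (hl : l < Q) (hkl : k ≠ l) :
    (modulus Q k).Coprime (modulus Q l) := by
  wlog h : k < l generalizing k l
  · exact (this hl hk hkl.symm (by omega)).symm
  refine Nat.coprime_of_dvd fun p hp h1 h2 => ?_
  have hlk : p ∣ l - k := by
    have e := (mul_modulus_add_one hk).trans (mul_modulus_add_one hl).symm
    have e' : (l - k) + (l + 1) * modulus Q l = (k + 1) * modulus Q k := by
      have : l - k + (k + 1) = l + 1 := by omega
      nlinarith
    exact (Nat.dvd_add_left (h2.mul_left (l + 1))).1 (e' ▸ h1.mul_left (k + 1))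
  have : p ∣ Q ! := hlk.trans (Nat.dvd_factorial (by omega) (by omega))
  exact hp.one_lt.ne' (Nat.eq_one_of_dvd_coprimes (coprime_modulus_factorial hk) h1 this)

/-- With `T = Q ! ^ 2 - 1`, the factor `(T - k) / (k + 1)` of the binomial is exactly the `k`-th
modulus. This makes the product of the moduli Diophantine. -/
theorem choose_eq_prod_modulus :
    ∀ {u}, u ≤ Q → (Q ! ^ 2 - 1).choose u = ∏ k ∈ Finset.range u, modulus Q k
  | 0, _ => by simp
  | u + 1, hu => by
    have h := Nat.choose_succ_right_eq (Q ! ^ 2 - 1) u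
    rw [choose_eq_prod_modulus (u := u) (by omega)] at h
    rw [Finset.prod_range_succ]
    refine Nat.eq_of_mul_eq_mul_right u.succ_pos ?_
    rw [Nat.succ_eq_add_one, h, mul_assoc]
    congr 1
    have := mul_modulus_add_one (k := u) hu
    have h2 : Q ! ^ 2 - 1 - u = Q ! ^ 2 - (u + 1) := by omega
    rw [h2, ← this, mul_add, mul_one, Nat.add_sub_cancel, mul_comm]

/-- As `T = (k + 1) * modulus Q k + k`, the single number `T` stands for every `k < Q` at once. -/
theorem modEq_modulus (hk : k < Q) : Q ! ^ 2 - 1 ≡ k [MOD modulus Q k] := by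
  rw [← mul_modulus_add_one hk, mul_add, mul_one, ← Nat.add_assoc, Nat.add_sub_cancel]
  simp [Nat.ModEq]

/-- Divisibility of `a.choose B` encodes that the residue of `a` is below `B`: the product `a (a -
1) ⋯ (a - B + 1)` contains `a - x`. The next lemma is the converse for primes. -/
theorem dvd_choose_of_modEq {M a x B : ℕ} (hM : M.Coprime B !) (hx : x < B)
    (h : a ≡ x [MOD M]) : M ∣ a.choose B := by
  refine hM.dvd_of_dvd_mul_left ?_
  rw [← Nat.descFactorial_eq_factorial_mul_choose, Nat.descFactorial_eq_prod_range]
  rcases le_or_gt x a with hxa | hxa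
  · exact ((Nat.modEq_iff_dvd' hxa).1 h.symm).trans
      (Finset.dvd_prod_of_mem (fun i => a - i) (Finset.mem_range.2 hx))
  · rw [← Nat.descFactorial_eq_prod_range, Nat.descFactorial_of_lt (hxa.trans hx)]
    exact dvd_zero _

theorem mod_lt_of_dvd_choose {p a B : ℕ} (hp : p.Prime) (hB : B < p) (h : p ∣ a.choose B) :
    a % p < B := by
  rcases lt_or_ge a B with ha | ha
  · exact (Nat.mod_le _ _).trans_lt ha
  have h1 : p ∣ a.descFactorial B := by
    rw [Nat.descFactorial_eq_factorial_mul_choose]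
    exact h.mul_left _
  rw [Nat.descFactorial_eq_prod_range] at h1
  obtain ⟨j, hj, hd⟩ := (Prime.dvd_finsetProd_iff hp.prime _).1 h1
  rw [Finset.mem_range] at hj
  have h2 : j ≡ a [MOD p] := (Nat.modEq_iff_dvd' (by omega)).2 hd
  rw [← h2, Nat.mod_eq_of_lt (by omega)]
  exact hj

/-- The Chinese remainder theorem packs the witnesses for all `k < u` into one tuple `a`, and
divisibility by `T.choose u` tests all moduli together. Conversely, `a` reduced modulo a prime
factor `p` of the `k`-th modulus is a witness for `k`: its entries are below `B`, so the value of
`F` is a multiple of `p` of size at most `G B < Q < p`, hence zero. -/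
theorem forall_exists_eq_zero_iff {ι : Type*} [Finite ι] (F : ℕ → (ι → ℕ) → ℤ) (G : ℕ → ℕ)
    (hF : ∀ n k l x y, k ≡ l [MOD n] → (∀ i, x i ≡ y i [MOD n]) → F k x ≡ F l y [ZMOD n])
    (hG : ∀ B k x, k < B → (∀ i, x i < B) → |F k x| ≤ G B) :
    (∀ k < u, ∃ x, F k x = 0) ↔
      ∃ B Q T, ∃ a : ι → ℕ, (u ≤ B ∧ B ≤ Q ∧ G B < Q ∧ 3 ≤ Q ∧ T = Q ! ^ 2 - 1) ∧
        (∀ i, T.choose u ∣ (a i).choose B) ∧ T.choose u ∣ (F T a).natAbs := by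
  constructor
  · intro h
    choose! x hx using h
    obtain ⟨C, hC⟩ : ∃ C, ∀ k < u, ∀ i, x k i < C := by
      have := Fintype.ofFinite ι
      refine ⟨(∑ k ∈ Finset.range u, ∑ i, x k i) + 1, fun k hk i => Nat.lt_succ_of_le ?_⟩
      exact (Finset.single_le_sum (fun _ _ => Nat.zero_le _) (Finset.mem_univ i)).trans
        (Finset.single_le_sum (f := fun k => ∑ i, x k i) (fun _ _ => Nat.zero_le _)
          (Finset.mem_range.2 hk))
    set B := u + C with hB
    set Q := B + G B + 3 with hQ'
    have hQ : 3 ≤ Q := by omega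
    have hc : Set.Pairwise (Finset.range u : Set ℕ) (Function.onFun Nat.Coprime (modulus Q)) := by
      intro k hk l hl hkl
      simp only [Finset.coe_range, Set.mem_Iio] at hk hl
      exact coprime_modulus (by omega) (by omega) hkl
    have ha (i : ι) : ∃ a, ∀ k < u, a ≡ x k i [MOD modulus Q k] := by
      obtain ⟨a, ha⟩ := Nat.chineseRemainderOfFinset (fun k => x k i) (modulus Q)
        (Finset.range u) (fun k hk => (one_lt_modulus hQ
          ((Finset.mem_range.1 hk).trans_le (by omega))).ne_bot) hc
      exact ⟨a, fun k hk => ha k (Finset.mem_range.2 hk)⟩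
    choose a ha using ha
    have hdvd (n : ℕ) (hn : ∀ k < u, modulus Q k ∣ n) : (Q ! ^ 2 - 1).choose u ∣ n := by
      rw [choose_eq_prod_modulus (by omega)]
      exact Finset.prod_dvd_of_isRelPrime
        (fun k hk l hl hkl => Nat.coprime_iff_isRelPrime.1 (hc hk hl hkl)) fun k hk => hn k (Finset.mem_range.1 hk)
    refine ⟨B, Q, Q ! ^ 2 - 1, a, ⟨by omega, by omega, by omega, hQ, rfl⟩, fun i => ?_, ?_⟩
    · refine hdvd _ fun k hk => dvd_choose_of_modEq (x := x k i) ?_ ?_ (ha i k hk)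
      · exact (coprime_modulus_factorial (by omega)).coprime_dvd_right
          (Nat.factorial_dvd_factorial (by omega))
      · exact (hC k hk i).trans_le (by omega)
    · refine hdvd _ fun k hk => ?_
      rw [← Int.natCast_dvd, ← Int.modEq_zero_iff_dvd, ← hx k hk]
      exact hF _ _ _ _ _ (modEq_modulus (by omega)) fun i => ha i k hk
  · rintro ⟨B, Q, T, a, ⟨huB, hBQ, hGQ, hQ, rfl⟩, ha, hT⟩ k hk
    have hkQ : k < Q := by omega
    obtain ⟨p, hp, hpM⟩ := Nat.exists_prime_and_dvd (one_lt_modulus hQ hkQ).ne'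
    -- Primes up to `Q` divide `Q !`, which is coprime to the modulus.
    have hpQ : Q < p := by
      by_contra! hle
      exact hp.one_lt.ne' (Nat.eq_one_of_dvd_coprimes (coprime_modulus_factorial hkQ) hpM
        (Nat.dvd_factorial hp.pos hle))
    have hpN : p ∣ (Q ! ^ 2 - 1).choose u := by
      rw [choose_eq_prod_modulus (by omega)]
      exact hpM.trans (Finset.dvd_prod_of_mem _ (Finset.mem_range.2 hk))
    have hlt (i : ι) : a i % p < B :=
      mod_lt_of_dvd_choose hp (by omega) (hpN.trans (ha i))
    refine ⟨fun i => a i % p, ?_⟩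
    have h1 : (p : ℤ) ∣ F k fun i => a i % p := by
      have h2 := hF p k (Q ! ^ 2 - 1) (fun i => a i % p) a
        ((modEq_modulus hkQ).of_dvd hpM).symm fun i => Nat.mod_modEq _ _
      exact Int.modEq_zero_iff_dvd.1
        (h2.trans (Int.modEq_zero_iff_dvd.2 (Int.natCast_dvd.2 (hpN.trans hT))))
    refine Int.eq_zero_of_abs_lt_dvd h1 ((hG B k _ (by omega) hlt).trans_lt ?_)
    exact_mod_cast (by omega : G B < p)

end BoundedQuantifier

namespace Dioph

open Sum

variable {α : Type}

/-- Diophantine predicates are closed under bounded universal quantification. -/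
theorem forall_lt_dioph {P : (α → ℕ) → ℕ → Prop} {f : (α → ℕ) → ℕ} (df : DiophFn f)
    (h : Dioph {w : Option α → ℕ | P (w ∘ some) (w none)}) :
    Dioph {v | ∀ k < f v, P v k} := by
  obtain ⟨m, p, hp⟩ := h.exists_fin_poly
  obtain ⟨q, hq⟩ := p.exists_monotone_bound
  have hP (v : α → ℕ) (k : ℕ) :
      P v k ↔ ∃ x, p (Sum.elim (Option.elim' k v) x) = 0 := hp (Option.elim' k v)
  have key (v : α → ℕ) := BoundedQuantifier.forall_exists_eq_zero_iff (u := f v)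
    (fun k x => p (Sum.elim (Option.elim' k v) x))
    (fun B => (q (Sum.elim (Option.elim' B v) fun _ => B)).natAbs)
    (fun n k l x y hkl hxy => p.modEq_of_forall_modEq (by
      rintro ((_ | i) | i)
      exacts [hkl, rfl, hxy i]))
    (fun B k x hk hx => (hq _ (Sum.elim (Option.elim' B v) fun _ => B) (by
      rintro ((_ | i) | i)
      exacts [hk.le, le_rfl, (hx i).le])).trans (by simpa using le_abs_self _))
  simp only [← hP] at key
  simp only [key]
  refine exists_dioph (exists_dioph (exists_dioph (exists_pi_dioph ?_)))
  let A := Option (Option (Option α)) ⊕ Fin m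
  have dB : DiophFn fun w : A → ℕ => w (inl (some (some none))) := proj_dioph _
  have dQ : DiophFn fun w : A → ℕ => w (inl (some none)) := proj_dioph _
  have dT : DiophFn fun w : A → ℕ => w (inl none) := proj_dioph _
  have dv : DiophFn fun w : A → ℕ => f (w ∘ (inl ∘ some ∘ some ∘ some)) := reindex_diophFn _ df
  have dN := choose_dioph dT dv
  -- The majorant is evaluated with `B` for `k` and for all witnesses; in `p` below, `T` takes the
  -- place of `k`.
  have dq := abs_poly_dioph (q.map (Sum.elim (Option.elim' (inl (some (some none)))
    (inl ∘ some ∘ some ∘ some)) (fun _ => inl (some (some none))) : _ → A))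
  have dp := abs_poly_dioph (p.map (Sum.elim (Option.elim' (inl none)
    (inl ∘ some ∘ some ∘ some)) inr : _ → A))
  have hvec {a : Option α → A} {b : Fin m → A} (w : A → ℕ) :
    w ∘ Sum.elim a b = Sum.elim (w ∘ a) (w ∘ b) := Sum.comp_elim _ _ _
  have hvec' {a : A} {b : α → A} (w : A → ℕ) :
    w ∘ Option.elim' a b = Option.elim' (w a) (w ∘ b) := by funext i; cases i <;> rfl
  simp only [Poly.map_apply, hvec, hvec'] at dq dp
  refine inter (inter (le_dioph dv dB) (inter (le_dioph dB dQ) (inter (lt_dioph dq dQ)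
    (inter (le_dioph (const_dioph 3) dQ) (eq_dioph dT
      (sub_dioph (pow_dioph (factorial_dioph dQ) (const_dioph 2)) (const_dioph 1)))))))
    (inter (forall_finite_dioph fun i => ?_) (dvd_dioph dN dp))
  exact dvd_dioph dN (choose_dioph (proj_dioph (inr i)) dB)

end Dioph

/-! ### Diophantine graphs of partial recursive functions -/

namespace Dioph

section

variable {α : Type} {f g : (α → ℕ) → ℕ}

theorem pair_dioph (df : DiophFn f) (dg : DiophFn g) : DiophFn fun v => Nat.pair (f v) (g v) := by
  have df' : DiophFn fun w : Option α → ℕ => f (w ∘ some) := reindex_diophFn some df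
  have dg' : DiophFn fun w : Option α → ℕ => g (w ∘ some) := reindex_diophFn some dg
  have dz : DiophFn fun w : Option α → ℕ => w none := proj_dioph none
  refine (union (inter (lt_dioph df' dg') (eq_dioph (add_dioph (mul_dioph dg' dg') df') dz))
    (inter (le_dioph dg' df')
      (eq_dioph (add_dioph (add_dioph (mul_dioph df' df') df') dg') dz))).ext fun w => ?_
  simp only [Set.mem_union, Set.mem_inter_iff, Set.mem_ofPred_eq, Nat.pair]
  split_ifs <;> omega

theorem unpair_fst_dioph (df : DiophFn f) : DiophFn fun v => (f v).unpair.1 := by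
  refine Dioph.ext (exists_dioph (P := fun w b => Nat.pair (w none) b = f (w ∘ some))
    (eq_dioph (pair_dioph (proj_dioph (some none)) (proj_dioph none))
      (reindex_diophFn (some ∘ some) df))) fun w => ?_
  constructor
  · rintro ⟨b, hb⟩
    change (f (w ∘ some)).unpair.1 = w none
    rw [← hb, Nat.unpair_pair]
  · intro hw
    exact ⟨(f (w ∘ some)).unpair.2, by rw [← hw, Nat.pair_unpair]⟩

theorem unpair_snd_dioph (df : DiophFn f) : DiophFn fun v => (f v).unpair.2 := by
  refine Dioph.ext (exists_dioph (P := fun w a => Nat.pair a (w none) = f (w ∘ some))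
    (eq_dioph (pair_dioph (proj_dioph none) (proj_dioph (some none)))
      (reindex_diophFn (some ∘ some) df))) fun w => ?_
  constructor
  · rintro ⟨b, hb⟩
    change (f (w ∘ some)).unpair.2 = w none
    rw [← hb, Nat.unpair_pair]
  · intro hw
    exact ⟨(f (w ∘ some)).unpair.1, by rw [← hw, Nat.pair_unpair]⟩

theorem beta_dioph (df : DiophFn f) (dg : DiophFn g) : DiophFn fun v => Nat.beta (f v) (g v) :=
  mod_dioph (unpair_fst_dioph df) (add_dioph (mul_dioph (add_dioph dg (const_dioph 1))
    (unpair_snd_dioph df)) (const_dioph 1))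

end

/-- The graph of a partial function is Diophantine, in a form that allows substitution. -/
def HasDiophGraph (f : ℕ → Part ℕ) : Prop :=
  ∀ ⦃α : Type⦄ ⦃g h : (α → ℕ) → ℕ⦄, DiophFn g → DiophFn h → Dioph {v | h v ∈ f (g v)}

namespace HasDiophGraph

variable {f g : ℕ → Part ℕ}

theorem of_total {f : ℕ → ℕ}
    (hf : ∀ ⦃α : Type⦄ ⦃g : (α → ℕ) → ℕ⦄, DiophFn g → DiophFn fun v => f (g v)) :
    HasDiophGraph (f : ℕ →. ℕ) := fun _ _ _ dg dh =>
  (eq_dioph dh (hf dg)).ext fun v => by simp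

theorem pair (hf : HasDiophGraph f) (hg : HasDiophGraph g) :
    HasDiophGraph fun n => Nat.pair <$> f n <*> g n := fun α i j di dj => by
  refine Dioph.ext (exists_dioph (P := fun v a => ∃ b, (a ∈ f (i v) ∧ b ∈ g (i v)) ∧
    Nat.pair a b = j v) (exists_dioph (inter (inter (hf ?_ ?_) (hg ?_ ?_)) (eq_dioph ?_ ?_))))
    fun v => ?_
  · exact reindex_diophFn (some ∘ some) di
  · exact proj_dioph (some none)
  · exact reindex_diophFn (some ∘ some) di
  · exact proj_dioph none
  · exact pair_dioph (proj_dioph (some none)) (proj_dioph none)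
  · exact reindex_diophFn (some ∘ some) dj
  · simp [Seq.seq, and_assoc]

theorem comp (hf : HasDiophGraph f) (hg : HasDiophGraph g) :
    HasDiophGraph fun n => g n >>= f := fun α i j di dj => by
  refine Dioph.ext (exists_dioph (P := fun v a => a ∈ g (i v) ∧ j v ∈ f a)
    (inter (hg ?_ ?_) (hf ?_ ?_))) fun v => ?_
  · exact reindex_diophFn some di
  · exact proj_dioph none
  · exact proj_dioph none
  · exact reindex_diophFn some dj
  · simp

/-- A recursion is unfolded into its sequence of intermediate values, so that in `prec` one number
can code it through `Nat.beta`. -/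
theorem mem_rec_iff {x : Part ℕ} {s : ℕ → ℕ → Part ℕ} {n z : ℕ} :
    z ∈ (Nat.rec x (fun y IH => IH >>= s y) n : Part ℕ) ↔
      ∃ c : ℕ → ℕ, (c 0 ∈ x ∧ c n = z) ∧ ∀ y < n, c (y + 1) ∈ s y (c y) := by
  induction n generalizing z with
  | zero =>
    constructor
    · exact fun h => ⟨fun _ => z, ⟨h, rfl⟩, fun y hy => absurd hy (Nat.not_lt_zero y)⟩
    · rintro ⟨c, ⟨h, rfl⟩, -⟩
      exact h
  | succ n ih =>
    simp only [Part.bind_eq_bind, Part.mem_bind_iff] at ih ⊢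
    simp only [ih]
    constructor
    · rintro ⟨b, ⟨c, ⟨h0, rfl⟩, hc⟩, hz⟩
      refine ⟨fun k => if k ≤ n then c k else z, ⟨by simpa using h0, by simp⟩, fun y hy => ?_⟩
      rcases (Nat.lt_succ_iff.1 hy).lt_or_eq with h | rfl
      · simpa [h.le, Nat.succ_le_of_lt h] using hc y h
      · simpa using hz
    · rintro ⟨c, ⟨h0, rfl⟩, hc⟩
      exact ⟨c n, ⟨c, ⟨h0, rfl⟩, fun y hy => hc y (by omega)⟩, hc n n.lt_succ_self⟩

theorem exists_beta_eq (c : ℕ → ℕ) (n : ℕ) : ∃ s, ∀ i ≤ n, Nat.beta s i = c i := by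
  refine ⟨Nat.unbeta ((List.range (n + 1)).map c), fun i hi => ?_⟩
  have := Nat.beta_unbeta_coe ((List.range (n + 1)).map c) ⟨i, by simp; omega⟩
  simpa using this

theorem prec (hf : HasDiophGraph f) (hg : HasDiophGraph g) :
    HasDiophGraph (Nat.unpaired fun a n =>
      n.rec (f a) fun y IH => do let i ← IH; g (Nat.pair a (Nat.pair y i))) := fun α i j di dj => by
  refine Dioph.ext (exists_dioph (P := fun v s =>
    (s.beta 0 ∈ f (i v).unpair.1 ∧ s.beta (i v).unpair.2 = j v) ∧ ∀ y < (i v).unpair.2,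
      s.beta (y + 1) ∈ g (Nat.pair (i v).unpair.1 (Nat.pair y (s.beta y))))
    (inter (inter (hf ?_ ?_) (eq_dioph ?_ ?_)) (forall_lt_dioph ?_ (hg ?_ ?_)))) fun v => ?_
  · exact unpair_fst_dioph (reindex_diophFn some di)
  · exact beta_dioph (proj_dioph none) (const_dioph 0)
  · exact beta_dioph (proj_dioph none) (unpair_snd_dioph (reindex_diophFn some di))
  · exact reindex_diophFn some dj
  · exact unpair_snd_dioph (reindex_diophFn some di)
  · exact pair_dioph (unpair_fst_dioph (reindex_diophFn (some ∘ some) di))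
      (pair_dioph (proj_dioph none) (beta_dioph (proj_dioph (some none)) (proj_dioph none)))
  · exact beta_dioph (proj_dioph (some none)) (add_dioph (proj_dioph none) (const_dioph 1))
  · rw [Set.mem_ofPred_eq, Set.mem_ofPred_eq, Nat.unpaired, mem_rec_iff]
    constructor
    · rintro ⟨s, h⟩
      exact ⟨s.beta, h⟩
    · rintro ⟨c, ⟨h0, hn⟩, hc⟩
      obtain ⟨s, hs⟩ := exists_beta_eq c (i v).unpair.2
      refine ⟨s, ⟨?_, ?_⟩, fun y hy => ?_⟩
      · rwa [hs 0 (Nat.zero_le _)]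
      · rwa [hs _ le_rfl]
      · rw [hs _ hy, hs _ hy.le]
        exact hc y hy

theorem rfind (hf : HasDiophGraph f) :
    HasDiophGraph fun a => Nat.rfind fun n => (fun m => m = 0) <$> f (Nat.pair a n) :=
    fun α i j di dj => by
  -- Earlier values must be defined and nonzero; writing them as `m + 1` keeps the condition
  -- existential.
  refine Dioph.ext (inter (hf (pair_dioph di dj) (const_dioph 0)) (forall_lt_dioph
    (P := fun v k => ∃ m, m + 1 ∈ f (Nat.pair (i v) k)) dj
    (exists_dioph (hf (pair_dioph ?_ ?_) (add_dioph ?_ (const_dioph 1)))))) fun v => ?_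
  · exact reindex_diophFn (some ∘ some) di
  · exact proj_dioph (some none)
  · exact proj_dioph none
  · refine Iff.trans ?_ Nat.mem_rfind.symm
    refine and_congr (by simp) (forall₂_congr fun k _ => ?_)
    simp only [Part.map_eq_map, Part.mem_map_iff]
    constructor
    · rintro ⟨m, hm⟩
      exact ⟨m + 1, hm, by simp⟩
    · rintro ⟨m, hm, h0⟩
      obtain ⟨l, rfl⟩ := Nat.exists_eq_succ_of_ne_zero (by simpa using h0)
      exact ⟨l, hm⟩

end HasDiophGraph

/-- The graph of every partial recursive function is Diophantine. -/
theorem _root_.Nat.Partrec.hasDiophGraph {f : ℕ →. ℕ} (hf : Nat.Partrec f) : HasDiophGraph f := by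
  induction hf with
  | zero => exact HasDiophGraph.of_total (f := fun _ => 0) fun _ _ _ => const_dioph 0
  | succ => exact HasDiophGraph.of_total fun _ _ dg => add_dioph dg (const_dioph 1)
  | left => exact HasDiophGraph.of_total fun _ _ dg => unpair_fst_dioph dg
  | right => exact HasDiophGraph.of_total fun _ _ dg => unpair_snd_dioph dg
  | pair _ _ hf hg => exact hf.pair hg
  | comp _ _ hf hg => exact hf.comp hg
  | prec _ _ hf hg => exact hf.prec hg
  | rfind _ hf => exact hf.rfind

/-- The **MRDP theorem**: recursively enumerable sets of natural numbers are Diophantine. -/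
theorem of_rePred {p : ℕ → Prop} (hp : REPred p) : Dioph {v : Unit → ℕ | p (v ())} := by
  have hf : Nat.Partrec fun n => (Part.assert (p n) fun _ => Part.some ()).map fun _ => 0 :=
    Partrec.nat_iff.1 (hp.map (Computable.const 0).to₂)
  exact Dioph.ext (exists_dioph (P := fun v a =>
    a ∈ (Part.assert (p (v ())) fun _ => Part.some ()).map fun _ => 0) (hf.hasDiophGraph (reindex_diophFn some (proj_dioph ()))
    (proj_dioph none))) fun v => by simp

end Dioph

theorem Poly.exists_mvPolynomial {α : Type*} (p : Poly α) :
    ∃ q : MvPolynomial α ℤ, ∀ v : α → ℕ, MvPolynomial.eval (fun i => (v i : ℤ)) q = p v := by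
  induction p using Poly.induction with
  | H1 i => exact ⟨MvPolynomial.X i, fun v => by simp⟩
  | H2 n => exact ⟨MvPolynomial.C n, fun v => by simp⟩
  | H3 f g hf hg =>
    obtain ⟨q, hq⟩ := hf
    obtain ⟨r, hr⟩ := hg
    exact ⟨q - r, fun v => by simp [hq, hr]⟩
  | H4 f g hf hg =>
    obtain ⟨q, hq⟩ := hf
    obtain ⟨r, hr⟩ := hg
    exact ⟨q * r, fun v => by simp [hq, hr]⟩

theorem REPred.comp_computable {α β : Type*} [Primcodable α] [Primcodable β] {p : β → Prop}
    (hp : REPred p) {f : α → β} (hf : Computable f) : REPred fun a => p (f a) :=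
  Partrec.comp hp hf

/-! ### The computable family of equations and the reduction -/

namespace DiophantineEquation

open MvPolynomial

theorem exists_sum_termOf_eq {M : ℕ} (D : MvPolynomial (Fin M) ℤ) :
    ∃ l : List (ℤ × List ℕ), (l.map (termOf M)).sum = D := by
  obtain ⟨⟨p, l⟩, h⟩ := ofCode_surjective ⟨M, D⟩
  obtain ⟨rfl, h⟩ := DiophantineEquation.mk.inj h
  exact ⟨l, eq_of_heq h⟩

/-- The list `l` repeated `n` times. -/
def repeatList {α : Type*} (l : List α) (n : ℕ) : List α :=
  n.rec [] fun _ m => l ++ m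

theorem sum_map_repeatList {α R : Type*} [CommRing R] (f : α → R) (l : List α) (n : ℕ) :
    ((repeatList l n).map f).sum = n * (l.map f).sum := by
  induction n with
  | zero => simp [repeatList]
  | succ n ih =>
    have : repeatList l (n + 1) = l ++ repeatList l n := rfl
    rw [this, List.map_append, List.sum_append, ih]
    push_cast
    ring

theorem primrec_repeatList {α : Type*} [Primcodable α] (l : List α) : Primrec (repeatList l) :=
  Primrec.nat_rec₁ _ (Primrec.list_append.comp (Primrec.const l) Primrec.snd).to₂

/-- The polynomials `q₀ + n q₁ + n² q₂` have codes that are computable from `n`. -/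
theorem exists_computable_code {M : ℕ} (q₀ q₁ q₂ : MvPolynomial (Fin M) ℤ) :
    ∃ e : ℕ → Code, Computable e ∧
      ∀ n : ℕ, ofCode (e n) = ⟨M, q₀ + n * q₁ + (n * n : ℕ) * q₂⟩ := by
  obtain ⟨l₀, rfl⟩ := exists_sum_termOf_eq q₀
  obtain ⟨l₁, rfl⟩ := exists_sum_termOf_eq q₁
  obtain ⟨l₂, rfl⟩ := exists_sum_termOf_eq q₂
  -- Repeating a list of terms multiplies its sum by `n` without any arithmetic on the coefficients.
  refine ⟨fun n => (M, l₀ ++ repeatList l₁ n ++ repeatList l₂ (n * n)), ?_, fun n => ?_⟩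
  · refine Primrec.to_comp (Primrec.pair (Primrec.const M) (Primrec.list_append.comp
      (Primrec.list_append.comp (Primrec.const l₀) (primrec_repeatList l₁))
      ((primrec_repeatList l₂).comp (Primrec.nat_mul.comp Primrec.id Primrec.id))))
  · simp only [ofCode, List.map_append, List.sum_append, sum_map_repeatList]

/-- If `q` has a root with nonnegative integer coordinates, the first of which is `n`, and does not
depend on the variable of index `2`, then this equation has infinitely many solutions; otherwise it
has none. In both cases its polynomial depends on all the variables. -/
noncomputable def fiberEquation {m : ℕ} (q : MvPolynomial (Fin (m + 3)) ℤ) (n : ℕ) :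
    DiophantineEquation where
  numVars := m + 3
  poly := (q ^ 2 + X 1 + (X 0 - (n : MvPolynomial (Fin (m + 3)) ℤ)) ^ 2) * ∏ i, (X i + 1)

variable {m : ℕ} (q : MvPolynomial (Fin (m + 3)) ℤ) (n : ℕ)

theorem mem_natSolutions_fiberEquation (x : Fin (m + 3) → ℕ) :
    x ∈ (fiberEquation q n).natSolutions ↔
      eval (fun i => (x i : ℤ)) q = 0 ∧ x 1 = 0 ∧ x 0 = n := by
  have hW : (∏ i, ((x i : ℤ) + 1)) ≠ 0 := Finset.prod_ne_zero_iff.2 fun i _ => by positivity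
  have : x ∈ (fiberEquation q n).natSolutions ↔ eval (fun i => (x i : ℤ))
    ((q ^ 2 + X 1 + (X 0 - (n : MvPolynomial (Fin (m + 3)) ℤ)) ^ 2) * ∏ i, (X i + 1)) = 0 := Iff.rfl
  rw [this]
  simp only [map_mul, map_add, map_pow, map_sub, map_prod, eval_X, map_natCast, map_one,
    mul_eq_zero, hW, or_false]
  constructor
  · intro h
    have h1 := sq_nonneg (eval (fun i => (x i : ℤ)) q)
    have h2 := sq_nonneg ((x 0 : ℤ) - n)
    have h3 : (0 : ℤ) ≤ x 1 := by positivity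
    have h4 : ((x 0 : ℤ) - n) ^ 2 = 0 := by linarith
    refine ⟨pow_eq_zero_iff two_ne_zero |>.1 (by linarith), ?_, ?_⟩
    · exact_mod_cast (by linarith : (x 1 : ℤ) = 0)
    · have := pow_eq_zero_iff two_ne_zero |>.1 h4
      omega
  · rintro ⟨h1, h2, h3⟩
    simp [h1, h2, h3]

/-- If `X i` did not occur, setting it to `-1`, which kills the factor `X i + 1`, would not change
the value. The summand `X 1` provides a point with positive value whatever `q` is. -/
theorem dependsOnAllVariables_fiberEquation : (fiberEquation q n).DependsOnAllVariables := by
  classical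
  intro i
  change Fin (m + 3) at i
  by_contra hi
  let x : Fin (m + 3) → ℤ := fun j => if j = 1 then 1 else 0
  have h : eval x (fiberEquation q n).poly =
      eval (Function.update x i (-1)) (fiberEquation q n).poly := by
    refine eval₂Hom_congr' rfl (fun j hj _ => ?_) rfl
    rw [Function.update_of_ne]
    rintro rfl
    exact hi hj
  have h0 : eval (Function.update x i (-1)) (fiberEquation q n).poly = 0 := by
    simp only [fiberEquation, map_mul, map_prod]
    exact mul_eq_zero_of_right _ (Finset.prod_eq_zero (Finset.mem_univ i) (by simp))
  have h1 : 0 < eval x (fiberEquation q n).poly := by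
    simp only [fiberEquation, map_mul, map_add, map_pow, map_sub, map_prod, eval_X, map_natCast,
      map_one]
    refine mul_pos ?_ (Finset.prod_pos fun j _ => ?_)
    · have : x 1 = 1 := by simp [x]
      rw [this]
      positivity
    · simp only [x]
      split_ifs <;> norm_num
  rw [h, h0] at h1
  exact lt_irrefl _ h1

/-- The reduction of the complement of a recursively enumerable set to finiteness of the number of
solutions. -/
theorem exists_computable_reduction {p : ℕ → Prop} (hp : REPred p) :
    ∃ e : ℕ → Code, Computable e ∧ ∀ n, 0 < (ofCode (e n)).numVars ∧
      (ofCode (e n)).DependsOnAllVariables ∧ ((ofCode (e n)).natSolutions.Finite ↔ ¬ p n) := by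
  obtain ⟨m, P, hP⟩ := (Dioph.of_rePred hp).exists_fin_poly
  let c : Unit ⊕ Fin m → Fin (m + 3) := Sum.elim (fun _ => 0) fun j => j.succ.succ.succ
  obtain ⟨q, hq⟩ := (P.map c).exists_mvPolynomial
  -- These are the coefficients of `1`, `n` and `n²` after expanding `(X 0 - n) ^ 2`.
  obtain ⟨e, he, heq⟩ := exists_computable_code
    ((q ^ 2 + X 1 + X 0 ^ 2) * ∏ i, (X i + 1)) (-2 * X 0 * ∏ i, (X i + 1)) (∏ i, (X i + 1))
  have heq' (n : ℕ) : ofCode (e n) = fiberEquation q n := by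
    rw [heq, fiberEquation]
    congr 1
    push_cast
    ring
  refine ⟨e, he, fun n => ?_⟩
  rw [heq']
  refine ⟨Nat.succ_pos _, dependsOnAllVariables_fiberEquation q n, ?_⟩
  constructor
  · intro hfin hpn
    obtain ⟨t, ht⟩ := (hP fun _ => n).1 hpn
    -- The coordinate of index 2 is free, since `c` avoids it.
    let x (y : ℕ) : Fin (m + 3) → ℕ := Fin.cons n (Fin.cons 0 (Fin.cons y t))
    have hx : Function.Injective x := fun y z h => congrFun h 2
    refine Set.infinite_of_injective_forall_mem hx (fun y => ?_) hfin
    refine (mem_natSolutions_fiberEquation q n (x y)).2 ⟨?_, rfl, rfl⟩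
    rw [hq, Poly.map_apply, ← ht]
    congr 1
    funext i
    cases i <;> rfl
  · intro hpn
    convert Set.finite_empty
    refine Set.eq_empty_of_forall_notMem fun (x : Fin (m + 3) → ℕ) hx => hpn ?_
    obtain ⟨h1, -, h3⟩ := (mem_natSolutions_fiberEquation q n x).1 hx
    rw [hq, Poly.map_apply] at h1
    refine (hP fun _ => n).2 ⟨x ∘ c ∘ Sum.inr, ?_⟩
    rw [← h1]
    congr 1
    funext i
    cases i with
    | inl _ => exact h3.symm
    | inr j => rfl

end DiophantineEquation

/-- This is the halting problem on input 0, transported from programs to their numbers. -/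
theorem exists_rePred_not_rePred_not : ∃ p : ℕ → Prop, REPred p ∧ ¬ REPred fun n => ¬ p n := by
  refine ⟨fun n => (Nat.Partrec.Code.eval (Denumerable.ofNat _ n) 0).Dom,
    (ComputablePred.halting_problem_re 0).comp_computable (Computable.ofNat _), fun h => ?_⟩
  refine ComputablePred.halting_problem_not_re 0 ?_
  simpa using h.comp_computable (Computable.encode (α := Nat.Partrec.Code))

theorem mainTheorem10 :
    ¬ DiophantineEquation.IsRecursivelyEnumerable
        {E : DiophantineEquation | E.natSolutions.Finite} ∧
    ¬ DiophantineEquation.IsRecursivelyEnumerable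
        {E : DiophantineEquation | 0 < E.numVars ∧ E.DependsOnAllVariables ∧
          E.natSolutions.Finite} := by
  obtain ⟨p, hp, hnp⟩ := exists_rePred_not_rePred_not
  obtain ⟨e, he, hep⟩ := DiophantineEquation.exists_computable_reduction hp
  refine ⟨fun h => hnp ?_, fun h => hnp ?_⟩
  · exact (h.comp_computable he).of_eq fun n => (hep n).2.2
  · refine (h.comp_computable he).of_eq fun n => ?_
    exact ⟨fun hn => (hep n).2.2.1 hn.2.2,
      fun hn => ⟨(hep n).1, (hep n).2.1, (hep n).2.2.2 hn⟩⟩
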